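/- **Setting.** Let $\mathcal K$ be the set of open double cones $\mathcal O=(a+V_+)\cap(b-V_+)$, $b-a\in V_+$ ($V_+$ the open forward light cone), in Minkowski space with at least two space dimensions, ordered by inclusion; write $\mathcal O_1\subset\mathcal O'$ if $\mathcal O_1$ is spacelike to $\mathcal O$. A $\mathbb Z_2$-graded net $\mathfrak F,k,\mathcal H$ consists of von Neumann algebras $\mathfrak F(\mathcal O)$, $\mathcal O\in\mathcal K$, on a complex Hilbert space $\mathcal H$, with $\mathfrak F(\mathcal O_1)\subset\mathfrak F(\mathcal O_2)$ for $\mathcal O_1\subset\mathcal O_2$, and a unitary $k$ with $k^2=1$ and $k\mathfrak F(\mathcal O)k=\mathfrak F(\mathcal O)$ for all $\mathcal O$. For a family $\mathfrak S$ of $k$-invariant linear spaces of operators $\mathfrak S(\mathcal O)$, $\mathcal O\in\mathcal K$, let $\mathfrak S_\pm(\mathcal O)=\{S\in\mathfrak S(\mathcal O): kSk=\pm S\}$, $\mathfrak S^t=\mathfrak S_++ik\,\mathfrak S_-$, and let the twisted dual be $$\mathfrak S^d(\mathcal O)=\bigcap_{\mathcal O_1\subset\mathcal O'}\mathfrak S^t(\mathcal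 O_1)'.$$ For a net $\mathfrak F$, $\mathfrak F^d$ is again a $\mathbb Z_2$-graded net with the same $\mathcal H$ and $k$. For a projection $E$ commuting with $k$, $E\mathfrak SE$ is the family $\mathcal O\mapsto E\mathfrak S(\mathcal O)E$ on $\mathcal H$, and ${}_E\mathfrak S$ is its restriction to $E\mathcal H$; duals of families on $E\mathcal H$ are formed on $E\mathcal H$ with $k|_{E\mathcal H}$ in place of $k$. $E$ is cyclic for $\mathfrak S$ if $\mathfrak S(\mathcal O)E\mathcal H$ spans a dense subspace of $\mathcal H$ for every $\mathcal O$. A conditional expectation on a net is a family of conditional expectations of the algebras $\mathfrak F(\mathcal O)$ (unital positive idempotent linear maps of $\mathfrak F(\mathcal O)$ to itself that are bimodule maps over their range) compatible with the inclusions $\mathfrak F(\mathcal O_1)\subset\mathfrak F(\mathcal O_2)$. **Corollary 3.3.** Let $\mathfrak F=\mathfrak F^{dd},k,\mathcal H$ be a $\mathbb Z_2$-graded net and $E$ a projection on $\mathcal H$ commuting with $k$ and cyclic for $\mathfrak F$ and for $\mathfrak F^d$. Then the following conditions are equivalent. - a) There is a conditional expectation $m$ on $\mathfrak F$ such that $m(F)E=EFE$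 for all $F\in\mathfrak F$. - a$'$) There is a conditional expectation $m^d$ on $\mathfrak F^d$ such that $m^d(F)E=EFE$ for all $F\in\mathfrak F^d$. - b) $E\mathfrak FE\subset(E\mathfrak F^dE)^d$. - b$'$) $E\mathfrak F^dE\subset(E\mathfrak FE)^d$. - c) $({}_E\mathfrak F)^d={}_E(\mathfrak F^d)$. - c$'$) $({}_E(\mathfrak F^d))^d={}_E\mathfrak F$. -/

import Mathlib

noncomputable section

/-- Minkowski space with one time dimension and `d` space dimensions. -/
abbrev Minkowski (d : ℕ) : Type := ℝ × EuclideanSpace ℝ (Fin d)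

namespace Minkowski

/-- The open forward light cone `V₊`. -/
def forwardCone (d : ℕ) : Set (Minkowski d) := {x | ‖x.2‖ < x.1}

/-- The double cone `(a + V₊) ∩ (b - V₊)` with vertices `a` and `b`. -/
def doubleConeSet {d : ℕ} (a b : Minkowski d) : Set (Minkowski d) :=
  {x | x - a ∈ forwardCone d ∧ b - x ∈ forwardCone d}

/-- The causal complement `S'`: all points that are spacelike to every point of `S`. -/
def causalComplement {d : ℕ} (S : Set (Minkowski d)) : Set (Minkowski d) :=
  {x | ∀ y ∈ S, |x.1 - y.1| < ‖x.2 - y.2‖}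

end Minkowski

/-- The set `𝒦` of (nonempty, open) double cones in Minkowski space; as a subtype of
`Set (Minkowski d)` it is ordered under inclusion. -/
abbrev DoubleCone (d : ℕ) : Type :=
  {O : Set (Minkowski d) //
    ∃ a b : Minkowski d, b - a ∈ Minkowski.forwardCone d ∧ O = Minkowski.doubleConeSet a b}

/-- `O₁ ⊂ O'`: the double cone `O₁` lies in the causal complement of `O`. -/
def DoubleCone.Spacelike {d : ℕ} (O₁ O : DoubleCone d) : Prop :=
  O₁.1 ⊆ Minkowski.causalComplement O.1

section OperatorNets

/-! Families of sets of bounded operators indexed by double cones, on a (pre-)Hilbert space `H`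
with an involution `k`. They need not consist of algebras. -/

variable {d : ℕ} {H : Type*} [NormedAddCommGroup H] [InnerProductSpace ℂ H]

/-- The twist `S₊ + i k S₋` of a set `S` of operators, where `S₊` (`S₋`) is the set of those
`A ∈ S` with `k A k = A` (`k A k = -A`). -/
def twist (k : H →L[ℂ] H) (S : Set (H →L[ℂ] H)) : Set (H →L[ℂ] H) :=
  {X | ∃ A ∈ S, ∃ B ∈ S, k * A * k = A ∧ k * B * k = -B ∧ X = A + Complex.I • (k * B)}

/-- The twisted dual `O ↦ ⋂_{O₁ ⊂ O'} Sᵗ(O₁)'` of a family `S` of sets of operators. -/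
def twistedDual (k : H →L[ℂ] H) (S : DoubleCone d → Set (H →L[ℂ] H)) :
    DoubleCone d → Set (H →L[ℂ] H) :=
  fun O => ⋂ O₁ : DoubleCone d, ⋂ _ : O₁.Spacelike O, Set.centralizer (twist k (S O₁))

/-- The family `E S E`, acting on `H`. -/
def corner (E : H →L[ℂ] H) (S : DoubleCone d → Set (H →L[ℂ] H)) :
    DoubleCone d → Set (H →L[ℂ] H) :=
  fun O => (fun A => E * A * E) '' S O

/-- The restriction of `E A E` to the subspace `E H`, as an operator on `E H`. -/
def compress (E A : H →L[ℂ] H) : E.range →L[ℂ] E.range :=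
  E.rangeRestrict ∘L A ∘L E.range.subtypeL

theorem coe_compress_apply (E A : H →L[ℂ] H) (hE : E * E = E) (x : E.range) :
    (compress E A x : H) = (E * A * E) (x : H) := by
  obtain ⟨_, y, rfl⟩ := x
  have h : E (E y) = E y := congrArg (fun T : H →L[ℂ] H => T y) hE
  simp [compress, h]

/-- The family `_E S` of operators on `E H`: the restriction of `E S E` to `E H`. -/
def compressedNet (E : H →L[ℂ] H) (S : DoubleCone d → Set (H →L[ℂ] H)) :
    DoubleCone d → Set (E.range →L[ℂ] E.range) :=
  fun O => compress E '' S O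

/-- `E` is cyclic for the family `S`: for each `O`, the vectors `A E x` with `A ∈ S O` and `x ∈ H`
span a dense subspace of `H`. -/
def IsCyclicFor (E : H →L[ℂ] H) (S : DoubleCone d → Set (H →L[ℂ] H)) : Prop :=
  ∀ O, (Submodule.span ℂ {y : H | ∃ A ∈ S O, ∃ x : H, y = A (E x)}).topologicalClosure = ⊤

end OperatorNets

/-- A (concrete) `ℤ₂`-graded net: a net of von Neumann algebras over the double cones, on the
Hilbert space `H`, with an involutive unitary `k` inducing an automorphism of the net. -/
structure GradedNet (d : ℕ) (H : Type*) [NormedAddCommGroup H] [InnerProductSpace ℂ H]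
    [CompleteSpace H] where
  algebra : DoubleCone d → VonNeumannAlgebra H
  isotony : ∀ O₁ O₂ : DoubleCone d, O₁ ≤ O₂ → algebra O₁ ≤ algebra O₂
  k : H →L[ℂ] H
  k_unitary : k ∈ unitary (H →L[ℂ] H)
  k_mul_k : k * k = 1
  k_conj_mem : ∀ (O : DoubleCone d), ∀ A ∈ algebra O, k * A * k ∈ algebra O

namespace GradedNet

variable {d : ℕ} {H : Type*} [NormedAddCommGroup H] [InnerProductSpace ℂ H] [CompleteSpace H]

/-- The underlying family of sets of operators. -/
def sets (F : GradedNet d H) : DoubleCone d → Set (H →L[ℂ] H) :=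
  fun O => (F.algebra O : Set (H →L[ℂ] H))

theorem star_k (F : GradedNet d H) : star F.k = F.k := by
  have h := (Unitary.mem_iff.1 F.k_unitary).1
  calc star F.k = star F.k * (F.k * F.k) := by rw [F.k_mul_k, mul_one]
    _ = F.k := by rw [← mul_assoc, h, one_mul]

theorem star_mem_twist (F : GradedNet d H) (O : DoubleCone d) {X : H →L[ℂ] H}
    (hX : X ∈ twist F.k (F.sets O)) : star X ∈ twist F.k (F.sets O) := by
  obtain ⟨A, hA, B, hB, hAk, hBk, rfl⟩ := hX
  have hB' : F.k * star B * F.k = -star B := by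
    have := congrArg star hBk
    simpa [F.star_k, mul_assoc] using this
  refine ⟨star A, star_mem (S := VonNeumannAlgebra H) hA, star B,
    star_mem (S := VonNeumannAlgebra H) hB, ?_, hB', ?_⟩
  · have := congrArg star hAk
    simpa [F.star_k, mul_assoc] using this
  · have h2 : star B * F.k = -(F.k * star B) := by
      calc star B * F.k = F.k * F.k * star B * F.k := by rw [F.k_mul_k, one_mul]
        _ = F.k * (F.k * star B * F.k) := by simp only [mul_assoc]
        _ = -(F.k * star B) := by rw [hB', mul_neg]
    rw [star_add, star_smul, star_mul, F.star_k, h2]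
    simp

theorem conj_mem_twist (F : GradedNet d H) (O : DoubleCone d) {X : H →L[ℂ] H}
    (hX : X ∈ twist F.k (F.sets O)) : F.k * X * F.k ∈ twist F.k (F.sets O) := by
  obtain ⟨A, hA, B, hB, hAk, hBk, rfl⟩ := hX
  refine ⟨A, hA, -B, neg_mem (S := VonNeumannAlgebra H) hB, hAk, by simp [hBk], ?_⟩
  rw [mul_add, add_mul, hAk, mul_smul_comm, smul_mul_assoc]
  congr 2
  rw [mul_assoc, hBk]

theorem twistedDual_eq (F : GradedNet d H) (O : DoubleCone d) :
    twistedDual F.k F.sets O =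
      (⋃ O₁ : DoubleCone d, ⋃ _ : O₁.Spacelike O, twist F.k (F.sets O₁)).centralizer := by
  ext X
  simp only [twistedDual, Set.mem_iInter, Set.mem_centralizer_iff, Set.mem_iUnion]
  exact ⟨fun h Y ⟨O₁, h₁, hY⟩ => h O₁ h₁ Y hY, fun h O₁ h₁ Y hY => h Y ⟨O₁, h₁, hY⟩⟩

/-- The twisted dual net `F^d`, with `F^d(O) = ⋂_{O₁ ⊂ O'} Fᵗ(O₁)'`, as a `ℤ₂`-graded net on the
same Hilbert space with the same `k`. -/
def dual (F : GradedNet d H) : GradedNet d H where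
  algebra O :=
    { carrier := twistedDual F.k F.sets O
      mul_mem' := by
        intro a b ha hb
        rw [twistedDual_eq] at *
        exact Set.mul_mem_centralizer ha hb
      one_mem' := by
        rw [twistedDual_eq]
        exact Set.one_mem_centralizer
      add_mem' := by
        intro a b ha hb
        rw [twistedDual_eq] at *
        exact Set.add_mem_centralizer ha hb
      zero_mem' := by
        rw [twistedDual_eq]
        exact Set.zero_mem_centralizer
      algebraMap_mem' := by
        intro c
        rw [twistedDual_eq]
        exact fun a _ => (Algebra.commutes c a).symm
      star_mem' := by
        intro a ha
        rw [twistedDual_eq] at *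
        refine Set.star_mem_centralizer' (fun Y hY => ?_) ha
        simp only [Set.mem_iUnion] at hY ⊢
        obtain ⟨O₁, h₁, hY⟩ := hY
        exact ⟨O₁, h₁, F.star_mem_twist O₁ hY⟩
      centralizer_centralizer' := by
        show Set.centralizer (Set.centralizer (twistedDual F.k F.sets O)) = _
        rw [twistedDual_eq]
        exact Set.centralizer_centralizer_centralizer _ }
  isotony O₁ O₂ h X hX := by
    change X ∈ twistedDual F.k F.sets O₁ at hX
    change X ∈ twistedDual F.k F.sets O₂
    simp only [twistedDual, Set.mem_iInter] at hX ⊢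
    exact fun O₃ h₃ => hX O₃ fun x hx y hy => h₃ hx y (h hy)
  k := F.k
  k_unitary := F.k_unitary
  k_mul_k := F.k_mul_k
  k_conj_mem O X hX := by
    change X ∈ twistedDual F.k F.sets O at hX
    change _ ∈ twistedDual F.k F.sets O
    simp only [twistedDual, Set.mem_iInter, Set.mem_centralizer_iff] at hX ⊢
    intro O₁ h₁ Y hY
    have h := hX O₁ h₁ _ (F.conj_mem_twist O₁ hY)
    calc Y * (F.k * X * F.k)
        = (F.k * F.k) * Y * (F.k * X * F.k) := by rw [F.k_mul_k, one_mul]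
      _ = F.k * ((F.k * Y * F.k) * X) * F.k := by simp only [mul_assoc]
      _ = F.k * X * F.k * Y * (F.k * F.k) := by rw [h]; simp only [mul_assoc]
      _ = F.k * X * F.k * Y := by rw [F.k_mul_k, mul_one]

theorem dual_sets (F : GradedNet d H) : F.dual.sets = twistedDual F.k F.sets := rfl

end GradedNet

section ConditionalExpectation

variable {d : ℕ} {H : Type*} [NormedAddCommGroup H] [InnerProductSpace ℂ H] [CompleteSpace H]

/-- A linear map `m : M → M` on a von Neumann algebra is a conditional expectation (onto its range,
which these axioms make a unital `*`-subalgebra) if it is an idempotent unital positive map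
that has the bimodule property over its range. -/
structure IsConditionalExpectation (M : VonNeumannAlgebra H)
    (m : M.toStarSubalgebra →ₗ[ℂ] M.toStarSubalgebra) : Prop where
  idem : ∀ X, m (m X) = m X
  map_one : m 1 = 1
  pos : ∀ X : M.toStarSubalgebra, (X : H →L[ℂ] H).IsPositive → (m X : H →L[ℂ] H).IsPositive
  bimodule : ∀ X Y Z, m (m X * Y * m Z) = m X * m Y * m Z

/-- A conditional expectation of a net: a family of conditional expectations of the local algebras
that is compatible with the inclusions `F(O₁) ⊂ F(O₂)`. -/
structure NetConditionalExpectation (F : GradedNet d H) where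
  map : ∀ O, (F.algebra O).toStarSubalgebra →ₗ[ℂ] (F.algebra O).toStarSubalgebra
  isConditionalExpectation : ∀ O, IsConditionalExpectation (F.algebra O) (map O)
  compatible : ∀ (O₁ O₂ : DoubleCone d) (h : O₁ ≤ O₂) (X : (F.algebra O₁).toStarSubalgebra),
    (map O₂ ⟨X, F.isotony O₁ O₂ h X.2⟩ : H →L[ℂ] H) = map O₁ X

/-- The net `F` has a conditional expectation `m` with `m(A) E = E A E` for all `A` in `F`. -/
def HasConditionalExpectationFor (F : GradedNet d H) (E : H →L[ℂ] H) : Prop :=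
  ∃ m : NetConditionalExpectation F, ∀ (O : DoubleCone d) (A : (F.algebra O).toStarSubalgebra),
    (m.map O A : H →L[ℂ] H) * E = E * (A : H →L[ℂ] H) * E

end ConditionalExpectation

end

/-!
Let `Z` be the Klein operator, a square root of `k`. The twist `Sᵗ` is `Z S Z⁻¹`, and conjugating by
`Z` once more gives `k S k = S`; hence `S ⊆ Tᵈ` is a symmetric relation between `S` and `T`, which
makes the two inclusions between the corners equivalent.

If `E` is cyclic for a `*`-algebra `𝒮`, an operator `X` commuting with `E 𝒮 E` determines an
element `T` of `𝒮'` with `T E = X E`, by `T (∑ A E x) = ∑ A E X x`. This is bounded by `‖X‖`,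
because `‖X‖² - X* X` has a square root that also commutes with `E 𝒮 E`. Applied to `𝒮 = Fᵗ(O₁)`
for all `O₁ ⊂ O'`, it gives extensions that agree for `O₁ ≤ O₂` by uniqueness, and therefore for all
`O₁`, because the causal complement of a double cone is connected in at least two space dimensions.
So `(E F E)ᵈ` lifts to `Fᵈ`. If `E Fᵈ E ⊆ (E F E)ᵈ`, lifting `E A E` for `A` in `Fᵈ` defines the
conditional expectation; it is positive since a lift `T` with `T E ≥ 0` satisfies `|T| E = T E`, and
so equals `|T|`.
-/

section Connectedness

open Set Topology

variable {V : Type*} [NormedAddCommGroup V] [NormedSpace ℝ V]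

theorem lineMap_notMem_of_convex {C : Set V} (hC : Convex ℝ C) {c v : V} (hc : c ∈ C) (hv : v ∉ C)
    {t : ℝ} (ht : 1 ≤ t) : AffineMap.lineMap c v t ∉ C := by
  intro hmem
  have ht0 : t ≠ 0 := by positivity
  refine hv ?_
  have h : AffineMap.lineMap c (AffineMap.lineMap c v t) t⁻¹ = v := by
    simp [AffineMap.lineMap_apply, smul_smul, ht0]
  rw [← h]
  exact hC.lineMap_mem hc hmem ⟨by positivity, inv_le_one_of_one_le₀ ht⟩

theorem isPreconnected_compl_of_convex_of_isBounded (hV : 1 < Module.rank ℝ V) {C : Set V}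
    (hC : Convex ℝ C) (hb : Bornology.IsBounded C) : IsPreconnected Cᶜ := by
  rcases C.eq_empty_or_nonempty with rfl | ⟨c, hc⟩
  · simpa using isPreconnected_univ
  obtain ⟨r, hr⟩ := hb.subset_closedBall c
  have ray : ∀ v ∉ C, ∀ R, dist v c ≤ R → ∃ s ⊆ Cᶜ, IsPreconnected s ∧ v ∈ s ∧
      (s ∩ Metric.sphere c R).Nonempty := by
    intro v hv R hR
    have hvc : 0 < dist v c := dist_pos.2 fun h => hv (h ▸ hc)
    have hone : 1 ≤ R / dist v c := (one_le_div hvc).2 hR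
    refine ⟨AffineMap.lineMap c v '' Icc (1 : ℝ) (R / dist v c), ?_,
      isPreconnected_Icc.image _ (by fun_prop), ⟨1, ⟨le_rfl, hone⟩, by simp⟩,
      _, mem_image_of_mem _ ⟨hone, le_rfl⟩, ?_⟩
    · rintro _ ⟨t, ht, rfl⟩
      exact lineMap_notMem_of_convex hC hc hv ht.1
    · rw [mem_sphere_iff_norm, ← dist_eq_norm, dist_lineMap_left, dist_comm c,
        Real.norm_of_nonneg (by positivity), div_mul_cancel₀ _ hvc.ne']
  refine isPreconnected_of_forall_pair fun v hv w hw => ?_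
  obtain ⟨R, hvR, hwR, hrR⟩ : ∃ R, dist v c ≤ R ∧ dist w c ≤ R ∧ r < R :=
    ⟨max (dist v c) (max (dist w c) (r + 1)), by simp, by simp, by simp⟩
  obtain ⟨s, hs, hsconn, hvs, x, hxs, hx⟩ := ray v hv R hvR
  obtain ⟨s', hs', hsconn', hws, y, hys, hy⟩ := ray w hw R hwR
  refine ⟨s ∪ Metric.sphere c R ∪ s', union_subset (union_subset hs fun z hz hzC => ?_) hs',
    Or.inl (Or.inl hvs), Or.inr hws,
    (hsconn.union x hxs hx (isPreconnected_sphere hV c R)).union y (Or.inr hy) hys hsconn'⟩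
  exact (hr hzC).not_gt (hz ▸ hrR)

theorem isPreconnected_ellipsoid_exterior (hV : 1 < Module.rank ℝ V) (a b : V) (r : ℝ) :
    IsPreconnected {p : V | r < ‖p - a‖ + ‖p - b‖} := by
  have hconv : ConvexOn ℝ univ fun p : V => dist p a + dist p b :=
    (convexOn_dist a convex_univ).add (convexOn_dist b convex_univ)
  have hbdd : {p | p ∈ univ ∧ dist p a + dist p b ≤ r} ⊆ Metric.closedBall a r := fun p hp =>
    (le_add_of_nonneg_right dist_nonneg).trans hp.2
  convert isPreconnected_compl_of_convex_of_isBounded hV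
    (hconv.convex_le r) (Metric.isBounded_closedBall.subset hbdd) using 1
  ext p
  simp [dist_eq_norm]

theorem isPreconnected_region_between {X : Type*} [TopologicalSpace X] {f g : X → ℝ}
    (hf : Continuous f) (hg : Continuous g) (h : IsPreconnected {x | f x < g x}) :
    IsPreconnected {p : ℝ × X | f p.2 < p.1 ∧ p.1 < g p.2} := by
  have himage : {p : ℝ × X | f p.2 < p.1 ∧ p.1 < g p.2} =
      (fun q : ℝ × X => (AffineMap.lineMap (f q.2) (g q.2) q.1, q.2)) ''
        (Ioo (0 : ℝ) 1 ×ˢ {x | f x < g x}) := by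
    ext ⟨t, x⟩
    constructor
    · intro ht
      obtain ⟨s, hs, rfl⟩ := (openSegment_eq_image_lineMap ℝ (f x) (g x)).subset
        ((openSegment_eq_Ioo (ht.1.trans ht.2)).symm.subset ht)
      exact ⟨(s, x), ⟨hs, ht.1.trans ht.2⟩, rfl⟩
    · rintro ⟨⟨s, y⟩, ⟨hs, hy : f y < g y⟩, heq⟩
      obtain ⟨rfl, rfl⟩ := Prod.mk.inj heq
      exact ⟨(left_lt_lineMap_iff_lt hs.1).2 hy, (lineMap_lt_right_iff_lt hs.2).2 hy⟩
  rw [himage]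
  refine (isPreconnected_Ioo.prod h).image _ (Continuous.continuousOn ?_)
  simp only [AffineMap.lineMap_apply_module]
  fun_prop

theorem eq_of_isPreconnected_iUnion {X ι α : Type*} [TopologicalSpace X] {s : ι → Set X}
    (hopen : ∀ i, IsOpen (s i)) (hne : ∀ i, (s i).Nonempty) (hconn : IsPreconnected (⋃ i, s i))
    {φ : ι → α} (hφ : ∀ i j, (s i ∩ s j).Nonempty → φ i = φ j) (i j : ι) : φ i = φ j := by
  by_contra hij
  obtain ⟨x, -, hx, hx'⟩ := hconn (⋃ l ∈ {l | φ l = φ j}, s l) (⋃ l ∈ {l | φ l ≠ φ j}, s l)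
    (isOpen_biUnion fun l _ => hopen l) (isOpen_biUnion fun l _ => hopen l)
    (iUnion_subset fun l => by
      by_cases hl : φ l = φ j
      · exact subset_union_of_subset_left (subset_biUnion_of_mem (u := s) hl) _
      · exact subset_union_of_subset_right (subset_biUnion_of_mem (u := s) hl) _)
    ((hne j).imp fun x hx => ⟨mem_iUnion_of_mem j hx, mem_biUnion (show φ j = φ j from rfl) hx⟩)
    ((hne i).imp fun x hx => ⟨mem_iUnion_of_mem i hx, mem_biUnion hij hx⟩)
  obtain ⟨l, hl, hxl⟩ := mem_iUnion₂.1 hx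
  obtain ⟨l', hl', hxl'⟩ := mem_iUnion₂.1 hx'
  exact hl' ((hφ l' l ⟨x, hxl', hxl⟩).trans hl)

end Connectedness

namespace Minkowski

open Set Topology

variable {d : ℕ} {a b p x y : Minkowski d}

theorem add_mem_forwardCone (hx : x ∈ forwardCone d) (hy : ‖y.2‖ ≤ y.1) :
    x + y ∈ forwardCone d :=
  (norm_add_le x.2 y.2).trans_lt (add_lt_add_of_lt_of_le hx hy)

theorem smul_mem_forwardCone (hx : x ∈ forwardCone d) {t : ℝ} (ht : 0 < t) :
    t • x ∈ forwardCone d := by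
  change ‖t • x.2‖ < t * x.1
  rw [norm_smul, Real.norm_of_nonneg ht.le]
  exact mul_lt_mul_of_pos_left hx ht

theorem isOpen_forwardCone : IsOpen (forwardCone d) :=
  isOpen_lt (by fun_prop) (by fun_prop)

theorem isOpen_doubleConeSet (a b : Minkowski d) : IsOpen (doubleConeSet a b) :=
  (isOpen_forwardCone.preimage (by fun_prop : Continuous fun x => x - a)).inter
    (isOpen_forwardCone.preimage (by fun_prop : Continuous fun x => b - x))

theorem openSegment_subset_doubleConeSet (hab : b - a ∈ forwardCone d) :
    openSegment ℝ a b ⊆ doubleConeSet a b := by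
  rw [openSegment_eq_image_lineMap]
  rintro _ ⟨t, ht, rfl⟩
  constructor
  · rw [← vsub_eq_sub, AffineMap.lineMap_vsub_left]
    exact smul_mem_forwardCone hab ht.1
  · rw [← vsub_eq_sub, AffineMap.right_vsub_lineMap]
    exact smul_mem_forwardCone hab (sub_pos.2 ht.2)

theorem segment_subset_closure_doubleConeSet (hab : b - a ∈ forwardCone d) :
    segment ℝ a b ⊆ closure (doubleConeSet a b) :=
  segment_subset_closure_openSegment.trans (closure_mono (openSegment_subset_doubleConeSet hab))

theorem mem_causalComplement_doubleConeSet (hab : b - a ∈ forwardCone d) :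
    p ∈ causalComplement (doubleConeSet a b) ↔ p - a ∉ forwardCone d ∧ b - p ∉ forwardCone d := by
  have hclosure := segment_subset_closure_doubleConeSet hab
  refine ⟨fun hp => ⟨fun hpa => ?_, fun hbp => ?_⟩, fun hp y hy => ?_⟩
  · obtain ⟨y, hpy : ‖p.2 - y.2‖ < p.1 - y.1, hy⟩ := mem_closure_iff.1
      (hclosure (left_mem_segment ℝ a b)) {y | p - y ∈ forwardCone d}
      (isOpen_forwardCone.preimage (continuous_const.sub continuous_id)) hpa
    exact ((le_abs_self _).trans_lt (hp y hy)).not_gt hpy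
  · obtain ⟨y, hyp : ‖y.2 - p.2‖ < y.1 - p.1, hy⟩ := mem_closure_iff.1
      (hclosure (right_mem_segment ℝ a b)) {y | y - p ∈ forwardCone d}
      (isOpen_forwardCone.preimage (continuous_id.sub continuous_const)) hbp
    have h := hp y hy
    rw [abs_sub_comm, norm_sub_rev] at h
    exact ((le_abs_self _).trans_lt h).not_gt hyp
  · by_contra! hle
    rcases le_abs'.1 hle with h | h
    · refine hp.2 ?_
      rw [← sub_add_sub_cancel b y p]
      refine add_mem_forwardCone hy.2 (?_ : ‖y.2 - p.2‖ ≤ y.1 - p.1)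
      rw [norm_sub_rev]
      linarith
    · refine hp.1 ?_
      rw [← sub_add_sub_cancel' y a p]
      exact add_mem_forwardCone hy.1 h

theorem interior_causalComplement_doubleConeSet (hab : b - a ∈ forwardCone d) :
    interior (causalComplement (doubleConeSet a b)) =
      {p | b.1 - ‖p.2 - b.2‖ < p.1 ∧ p.1 < a.1 + ‖p.2 - a.2‖} := by
  have mem_iff : ∀ q : Minkowski d, q ∈ causalComplement (doubleConeSet a b) ↔
      b.1 - ‖q.2 - b.2‖ ≤ q.1 ∧ q.1 ≤ a.1 + ‖q.2 - a.2‖ := by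
    intro q
    rw [mem_causalComplement_doubleConeSet hab, norm_sub_rev q.2 b.2, and_comm, sub_le_comm,
      ← sub_le_iff_le_add']
    change ¬‖b.2 - q.2‖ < b.1 - q.1 ∧ ¬‖q.2 - a.2‖ < q.1 - a.1 ↔ _
    rw [not_lt, not_lt]
  refine Subset.antisymm (fun p hp => ?_) (interior_maximal (fun p hp => ?_) ?_)
  · have hshift : ∀ᶠ t : ℝ in 𝓝 0, (p.1 + t, p.2) ∈ causalComplement (doubleConeSet a b) :=
      ContinuousAt.eventually_mem (by fun_prop)
        (by simpa using mem_interior_iff_mem_nhds.1 hp)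
    obtain ⟨s, hs, hs0⟩ := ((hshift.filter_mono nhdsWithin_le_nhds).and
      (self_mem_nhdsWithin (s := Iio 0))).exists
    obtain ⟨t, ht, ht0⟩ := ((hshift.filter_mono nhdsWithin_le_nhds).and
      (self_mem_nhdsWithin (s := Ioi 0))).exists
    exact ⟨((mem_iff _).1 hs).1.trans_lt (add_lt_of_neg_right _ hs0),
      (lt_add_of_pos_right _ ht0).trans_le ((mem_iff _).1 ht).2⟩
  · exact (mem_iff p).2 ⟨hp.1.le, hp.2.le⟩
  · exact (isOpen_lt (f := fun p : Minkowski d => b.1 - ‖p.2 - b.2‖) (by fun_prop)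
      (by fun_prop)).inter (isOpen_lt (g := fun p : Minkowski d => a.1 + ‖p.2 - a.2‖)
      (by fun_prop) (by fun_prop))

theorem isPreconnected_interior_causalComplement (hd : 2 ≤ d) (hab : b - a ∈ forwardCone d) :
    IsPreconnected (interior (causalComplement (doubleConeSet a b))) := by
  have hrank : 1 < Module.rank ℝ (EuclideanSpace ℝ (Fin d)) := by
    rw [← Module.finrank_eq_rank, finrank_euclideanSpace_fin]
    exact_mod_cast hd
  rw [interior_causalComplement_doubleConeSet hab]
  refine isPreconnected_region_between (f := fun v => b.1 - ‖v - b.2‖)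
    (g := fun v => a.1 + ‖v - a.2‖) (by fun_prop) (by fun_prop) ?_
  have hext := isPreconnected_ellipsoid_exterior hrank a.2 b.2 (b.1 - a.1)
  simp only [sub_lt_iff_lt_add', ← add_assoc] at hext
  simpa only [sub_lt_iff_lt_add] using hext

theorem interior_causalComplement_nonempty (hd : 1 ≤ d) (hab : b - a ∈ forwardCone d) :
    (interior (causalComplement (doubleConeSet a b))).Nonempty := by
  have : NeZero d := ⟨by omega⟩
  obtain ⟨v, hv⟩ := NormedSpace.exists_lt_norm ℝ (EuclideanSpace ℝ (Fin d))
    (b.1 - a.1 + ‖b.2 - a.2‖)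
  have hab' : ‖b.2 - a.2‖ < b.1 - a.1 := hab
  have htriangle : ‖v‖ ≤ ‖a.2 + v - b.2‖ + ‖b.2 - a.2‖ := by
    simpa using norm_add_le (a.2 + v - b.2) (b.2 - a.2)
  have := norm_nonneg (b.2 - a.2)
  rw [interior_causalComplement_doubleConeSet hab]
  refine ⟨(a.1, a.2 + v), ?_, ?_⟩
  · change b.1 - ‖a.2 + v - b.2‖ < a.1
    linarith
  · change a.1 < a.1 + ‖a.2 + v - a.2‖
    rw [add_sub_cancel_left]
    linarith

end Minkowski

namespace DoubleCone

open Minkowski Set Topology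

variable {d : ℕ}

theorem isOpen (O : DoubleCone d) : IsOpen O.1 := by
  obtain ⟨_, a, b, -, rfl⟩ := O
  exact isOpen_doubleConeSet a b

theorem nonempty (O : DoubleCone d) : O.1.Nonempty := by
  obtain ⟨_, a, b, hab, rfl⟩ := O
  exact ⟨_, openSegment_subset_doubleConeSet hab (midpoint_mem_openSegment a b)⟩

theorem Spacelike.symm {O₁ O : DoubleCone d} (h : O₁.Spacelike O) : O.Spacelike O₁ := by
  intro x hx y hy
  rw [abs_sub_comm, norm_sub_rev]
  exact h hy x hx

theorem exists_subset_of_mem_nhds {U : Set (Minkowski d)} {p : Minkowski d} (hU : U ∈ 𝓝 p) :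
    ∃ O : DoubleCone d, p ∈ O.1 ∧ O.1 ⊆ U := by
  obtain ⟨ε, hε, hball⟩ := Metric.mem_nhds_iff.1 hU
  have hab : p + (ε, 0) - (p - (ε, 0)) ∈ forwardCone d := by simp [forwardCone, hε]
  refine ⟨⟨_, p - (ε, 0), p + (ε, 0), hab, rfl⟩, by simp [doubleConeSet, forwardCone, hε],
    fun q hq => hball ?_⟩
  have h₁ : ‖q.2 - (p.2 - 0)‖ < q.1 - (p.1 - ε) := hq.1
  have h₂ : ‖p.2 + 0 - q.2‖ < p.1 + ε - q.1 := hq.2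
  rw [sub_zero] at h₁
  rw [add_zero, norm_sub_rev] at h₂
  rw [mem_ball_iff_norm, Prod.norm_def, max_lt_iff, Real.norm_eq_abs, abs_lt]
  have := norm_nonneg (q.2 - p.2)
  refine ⟨⟨?_, ?_⟩, ?_⟩ <;> simp only [Prod.fst_sub, Prod.snd_sub] <;> linarith

theorem iUnion_spacelike (O : DoubleCone d) :
    ⋃ O₁ : {O₁ : DoubleCone d // O₁.Spacelike O}, O₁.1.1 = interior (causalComplement O.1) := by
  refine Subset.antisymm (iUnion_subset fun O₁ => interior_maximal O₁.2 O₁.1.isOpen) fun p hp => ?_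
  obtain ⟨O₁, hpO₁, hO₁⟩ := exists_subset_of_mem_nhds (mem_interior_iff_mem_nhds.1 hp)
  exact mem_iUnion.2 ⟨⟨O₁, hO₁⟩, hpO₁⟩

theorem exists_spacelike (hd : 1 ≤ d) (O : DoubleCone d) :
    ∃ O₁ : DoubleCone d, O₁.Spacelike O := by
  have hne : (interior (causalComplement O.1)).Nonempty := by
    obtain ⟨_, a, b, hab, rfl⟩ := O
    exact interior_causalComplement_nonempty hd hab
  rw [← iUnion_spacelike, nonempty_iUnion] at hne
  obtain ⟨⟨O₁, hO₁⟩, -⟩ := hne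
  exact ⟨O₁, hO₁⟩

theorem eq_of_spacelike {α : Type*} (hd : 2 ≤ d) {O : DoubleCone d} {φ : DoubleCone d → α}
    (hφ : ∀ O₁ O₂, O₂.Spacelike O → O₁ ≤ O₂ → φ O₁ = φ O₂) {O₁ O₂ : DoubleCone d}
    (h₁ : O₁.Spacelike O) (h₂ : O₂.Spacelike O) : φ O₁ = φ O₂ := by
  have hconn : IsPreconnected (interior (causalComplement O.1)) := by
    obtain ⟨_, a, b, hab, rfl⟩ := O
    exact isPreconnected_interior_causalComplement hd hab
  rw [← iUnion_spacelike] at hconn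
  refine eq_of_isPreconnected_iUnion (fun O₁ => O₁.1.isOpen) (fun O₁ => O₁.1.nonempty) hconn
    (φ := fun O₁ => φ O₁.1) ?_ ⟨O₁, h₁⟩ ⟨O₂, h₂⟩
  rintro ⟨O₃, h₃⟩ ⟨O₄, h₄⟩ ⟨p, hp⟩
  obtain ⟨O₅, -, h₅⟩ := exists_subset_of_mem_nhds ((O₃.isOpen.inter O₄.isOpen).mem_nhds hp)
  exact (hφ O₅ O₃ h₃ (h₅.trans inter_subset_left)).symm.trans
    (hφ O₅ O₄ h₄ (h₅.trans inter_subset_right))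

end DoubleCone

section Extension

open scoped InnerProductSpace

variable {H : Type*} [NormedAddCommGroup H] [InnerProductSpace ℂ H]

/-- `E` is cyclic for a single set `S` of operators: the vectors `A E x` with `A ∈ S` and `x ∈ H`
span a dense subspace. `IsCyclicFor E` is this condition for every member of a family. -/
def IsCyclicForSet (E : H →L[ℂ] H) (S : Set (H →L[ℂ] H)) : Prop :=
  Dense (Submodule.span ℂ {y : H | ∃ A ∈ S, ∃ x : H, y = A (E x)} : Set H)

theorem isCyclicFor_iff {d : ℕ} {E : H →L[ℂ] H} {S : DoubleCone d → Set (H →L[ℂ] H)} :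
    IsCyclicFor E S ↔ ∀ O, IsCyclicForSet E (S O) :=
  forall_congr' fun _ => Submodule.dense_iff_topologicalClosure_eq_top.symm

namespace IsCyclicForSet

variable {E : H →L[ℂ] H} {S : Set (H →L[ℂ] H)}

theorem eq_of_mul_mul_eq (hcyc : IsCyclicForSet E S) {T T' : H →L[ℂ] H}
    (h : ∀ A ∈ S, T * A * E = T' * A * E) : T = T' := by
  refine ContinuousLinearMap.ext_on hcyc ?_
  rintro _ ⟨A, hA, x, rfl⟩
  exact DFunLike.congr_fun (h A hA) x

theorem injOn_mul_right_centralizer (hcyc : IsCyclicForSet E S) :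
    Set.InjOn (· * E) S.centralizer := by
  intro T hT T' hT' (h : T * E = T' * E)
  refine hcyc.eq_of_mul_mul_eq fun A hA => ?_
  rw [← hT A hA, ← hT' A hA, mul_assoc, h, mul_assoc]

theorem image_conj (hcyc : IsCyclicForSet E S) {Z Z' : H →L[ℂ] H} (hZZ' : Z * Z' = 1)
    (hZ'Z : Z' * Z = 1) (hZE : Commute Z E) : IsCyclicForSet E ((fun A => Z * A * Z') '' S) := by
  have hsurj : Function.Surjective Z := fun x => ⟨Z' x, DFunLike.congr_fun hZZ' x⟩
  refine (hsurj.denseRange.dense_image Z.continuous hcyc).mono ?_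
  change (Submodule.map (Z : H →ₗ[ℂ] H) _ : Set H) ⊆ _
  rw [Submodule.map_span]
  refine Submodule.span_mono ?_
  rintro _ ⟨_, ⟨A, hA, x, rfl⟩, rfl⟩
  refine ⟨_, Set.mem_image_of_mem _ hA, Z x, ?_⟩
  have hconj : Z * A * Z' * E * Z = Z * A * E := by
    rw [mul_assoc _ E, ← hZE.eq, mul_assoc _ Z', ← mul_assoc Z', hZ'Z, one_mul]
  exact (DFunLike.congr_fun hconj x).symm

end IsCyclicForSet

/-- The linear map `f ↦ ∑ A E Y f(A)` on finitely supported functions `f : S → H`, depending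
linearly on the operator `Y`. An operator `T` with `T A = A T` for `A ∈ S` and `T E = E Y` maps
`cyclicMap S E 1 f` to `cyclicMap S E Y f`, which determines it if `E` is cyclic for `S`. -/
noncomputable def cyclicMap (S : Set (H →L[ℂ] H)) (E : H →L[ℂ] H) :
    (H →L[ℂ] H) →ₗ[ℂ] (S →₀ H) →ₗ[ℂ] H :=
  (Finsupp.lsum ℂ).toLinearMap ∘ₗ LinearMap.pi fun A : S =>
    ContinuousLinearMap.coeLM ℂ ∘ₗ LinearMap.mulLeft ℂ (A.1 * E)

theorem cyclicMap_apply (S : Set (H →L[ℂ] H)) (E Y : H →L[ℂ] H) (f : S →₀ H) :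
    cyclicMap S E Y f = f.sum fun A x => (A.1 * E * Y) x :=
  rfl

theorem cyclicMap_single (S : Set (H →L[ℂ] H)) (E Y : H →L[ℂ] H) (A : S) (x : H) :
    cyclicMap S E Y (Finsupp.single A x) = (A.1 * E * Y) x :=
  (cyclicMap_apply S E Y _).trans (Finsupp.sum_single_index (map_zero (A.1 * E * Y)))

theorem IsCyclicForSet.denseRange_cyclicMap {E : H →L[ℂ] H} {S : Set (H →L[ℂ] H)}
    (hcyc : IsCyclicForSet E S) : DenseRange (cyclicMap S E 1) := by
  refine hcyc.mono (Submodule.span_le (p := LinearMap.range (cyclicMap S E 1)).2 ?_)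
  rintro _ ⟨A, hA, x, rfl⟩
  exact ⟨Finsupp.single ⟨A, hA⟩ x, cyclicMap_single S E 1 ⟨A, hA⟩ x⟩

variable [CompleteSpace H] {S : Submonoid (H →L[ℂ] H)} {E X : H →L[ℂ] H}

theorem commute_star_corner (hS : ∀ A ∈ S, star A ∈ S) (hE : IsSelfAdjoint E)
    (hX : ∀ A ∈ S, Commute X (E * A * E)) : ∀ A ∈ S, Commute (star X) (E * A * E) := by
  intro A hA
  simpa [hE.star_eq, mul_assoc] using (hX (star A) (hS A hA)).star_star

theorem inner_cyclicMap (hS : ∀ A ∈ S, star A ∈ S) (hE : IsSelfAdjoint E)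
    (hX : ∀ A ∈ S, Commute X (E * A * E)) (Y : H →L[ℂ] H) (f : (S : Set (H →L[ℂ] H)) →₀ H) :
    ⟪cyclicMap S E X f, cyclicMap S E Y f⟫_ℂ =
      ⟪cyclicMap S E 1 f, cyclicMap S E (star X * Y) f⟫_ℂ := by
  simp only [cyclicMap_apply, Finsupp.sum_inner, Finsupp.inner_sum]
  refine Finset.sum_congr rfl fun A _ => Finset.sum_congr rfl fun B _ => ?_
  have hcomm := (commute_star_corner hS hE hX _ (S.mul_mem (hS _ B.2) A.2)).eq
  have hadjoint : star (B.1 * E * X) * (A.1 * E * Y) =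
      star (B.1 * E * 1) * (A.1 * E * (star X * Y)) := by
    calc star (B.1 * E * X) * (A.1 * E * Y)
        = star X * (E * (star B.1 * A.1) * E) * Y := by
          simp only [star_mul, hE.star_eq, mul_assoc]
      _ = star (B.1 * E * 1) * (A.1 * E * (star X * Y)) := by
          rw [hcomm]
          simp only [star_mul, hE.star_eq, star_one, one_mul, mul_assoc]
  have h := congrArg (fun T : H →L[ℂ] H => ⟪f B, T (f A)⟫_ℂ) hadjoint
  simpa [ContinuousLinearMap.star_eq_adjoint, ContinuousLinearMap.adjoint_inner_right] using h

theorem norm_cyclicMap_le (hS : ∀ A ∈ S, star A ∈ S) (hE : IsSelfAdjoint E)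
    (hX : ∀ A ∈ S, Commute X (E * A * E)) (f : (S : Set (H →L[ℂ] H)) →₀ H) :
    ‖cyclicMap S E X f‖ ≤ ‖X‖ * ‖cyclicMap S E 1 f‖ := by
  set Q : H →L[ℂ] H := algebraMap ℝ (H →L[ℂ] H) (‖X‖ ^ 2) - star X * X with hQ
  have hQ0 : 0 ≤ Q := sub_nonneg.2 CStarAlgebra.star_mul_le_algebraMap_norm_sq
  have hQcomm : ∀ A ∈ S, Commute Q (E * A * E) := fun A hA =>
    (Algebra.commute_algebraMap_left _ _).sub_left
      ((commute_star_corner hS hE hX A hA).mul_left (hX A hA))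
  set D := CFC.sqrt Q
  have hDcomm : ∀ A ∈ S, Commute D (E * A * E) := fun A hA => (hQcomm A hA).cfcₙ_nnreal _
  have hinner := inner_cyclicMap hS hE hDcomm D f
  rw [(CFC.sqrt_nonneg Q).isSelfAdjoint.star_eq, CFC.sqrt_mul_sqrt_self Q hQ0, hQ, map_sub,
    LinearMap.sub_apply, inner_sub_right, ← inner_cyclicMap hS hE hX,
    Algebra.algebraMap_eq_smul_one, ← Complex.coe_smul, map_smul, LinearMap.smul_apply,
    inner_smul_right, inner_self_eq_norm_sq_to_K, inner_self_eq_norm_sq_to_K,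
    inner_self_eq_norm_sq_to_K] at hinner
  have hnorm : ‖cyclicMap S E D f‖ ^ 2 =
      ‖X‖ ^ 2 * ‖cyclicMap S E 1 f‖ ^ 2 - ‖cyclicMap S E X f‖ ^ 2 := by
    refine Complex.ofReal_injective ?_
    push_cast at hinner ⊢
    exact hinner
  refine le_of_sq_le_sq ?_ (by positivity)
  rw [mul_pow, ← sub_nonneg, ← hnorm]
  positivity

theorem exists_mem_centralizer_extension (hS : ∀ A ∈ S, star A ∈ S) (hE : IsStarProjection E)
    (hcyc : IsCyclicForSet E (S : Set (H →L[ℂ] H))) (hX : ∀ A ∈ S, Commute X (E * A * E)) :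
    ∃ T ∈ Set.centralizer (S : Set (H →L[ℂ] H)), Commute T E ∧ T * E = X * E := by
  have hEE : E * E = E := hE.isIdempotentElem
  have hXE : Commute X E := by simpa [hEE] using hX 1 S.one_mem
  set T := (cyclicMap S E X).extendOfNorm (cyclicMap S E 1)
  have hT : ∀ A ∈ S, T * A * E = A * E * X := by
    intro A hA
    ext x
    have h := LinearMap.extendOfNorm_eq (f := cyclicMap S E X) hcyc.denseRange_cyclicMap
      ⟨‖X‖, norm_cyclicMap_le hS hE.isSelfAdjoint hX⟩ (Finsupp.single ⟨A, hA⟩ x)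
    rw [cyclicMap_single, cyclicMap_single, mul_one] at h
    exact h
  have hTE : T * E = E * X := by simpa using hT 1 S.one_mem
  refine ⟨T, fun A hA => ?_, ?_, hTE.trans hXE.eq.symm⟩
  · refine hcyc.eq_of_mul_mul_eq fun B hB => ?_
    rw [mul_assoc T, hT _ (S.mul_mem hA hB), mul_assoc A T, mul_assoc A, hT B hB]
    simp only [mul_assoc]
  · refine hcyc.eq_of_mul_mul_eq fun A hA => ?_
    calc T * E * A * E = X * (E * A * E) := by rw [hTE, ← hXE.eq]; simp only [mul_assoc]
      _ = E * (T * A * E) := by rw [(hX A hA).eq, hT A hA]; simp only [mul_assoc]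
      _ = E * T * A * E := by simp only [mul_assoc]

end Extension

section KleinTransformation

open Complex

variable {H H' : Type*} [NormedAddCommGroup H] [InnerProductSpace ℂ H]
  [NormedAddCommGroup H'] [InnerProductSpace ℂ H'] {k : H →L[ℂ] H} {k' : H' →L[ℂ] H'}

/-- The Klein operator of an involution `k`: the square root of `k` with eigenvalues `1` where
`k = 1` and `-i` where `k = -1`. -/
noncomputable def kleinUnit (k : H →L[ℂ] H) (hk : k * k = 1) : (H →L[ℂ] H)ˣ where
  val := (1 / 2 : ℂ) • ((1 - I) • 1 + (1 + I) • k)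
  inv := (1 / 2 : ℂ) • ((1 + I) • 1 + (1 - I) • k)
  val_inv := by
    simp only [smul_mul_smul_comm, mul_add, add_mul, mul_one, one_mul, hk]
    match_scalars
    · linear_combination (-1 / 2 : ℂ) * I_sq
    · linear_combination (1 / 2 : ℂ) * I_sq
  inv_val := by
    simp only [smul_mul_smul_comm, mul_add, add_mul, mul_one, one_mul, hk]
    match_scalars
    · linear_combination (-1 / 2 : ℂ) * I_sq
    · linear_combination (1 / 2 : ℂ) * I_sq

/-- The Klein transformation: conjugation by the Klein operator of `k`. It fixes the even operators
and multiplies the odd ones by `i k` from the left, so that it implements the twist. -/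
noncomputable def kleinAut (k : H →L[ℂ] H) (hk : k * k = 1) :
    (H →L[ℂ] H) ≃ₐ[ℂ] (H →L[ℂ] H) :=
  MulSemiringAction.toAlgEquiv ℂ _ (ConjAct.toConjAct (kleinUnit k hk))

theorem kleinAut_apply (hk : k * k = 1) (A : H →L[ℂ] H) :
    kleinAut k hk A = kleinUnit k hk * A * ↑(kleinUnit k hk)⁻¹ :=
  rfl

theorem kleinAut_eq (hk : k * k = 1) (A : H →L[ℂ] H) :
    kleinAut k hk A = (1 / 2 : ℂ) • (A + k * A * k) + (I / 2) • (k * A - A * k) := by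
  simp only [kleinAut_apply, kleinUnit, Units.inv_mk, smul_mul_assoc, mul_smul_comm, mul_add,
    add_mul, one_mul, mul_one]
  match_scalars
  · linear_combination (-1 / 4 : ℂ) * I_sq
  · linear_combination (1 / 4 : ℂ) * I_sq
  · linear_combination (1 / 4 : ℂ) * I_sq
  · linear_combination (-1 / 4 : ℂ) * I_sq

theorem kleinAut_kleinAut (hk : k * k = 1) (A : H →L[ℂ] H) :
    kleinAut k hk (kleinAut k hk A) = k * A * k := by
  have hkk : ∀ X : H →L[ℂ] H, k * (k * X) = X := fun X => by rw [← mul_assoc, hk, one_mul]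
  simp only [kleinAut_eq, mul_add, add_mul, mul_sub, sub_mul, smul_mul_assoc, mul_smul_comm,
    mul_assoc, hkk, hk, mul_one]
  match_scalars
  · linear_combination (1 / 2 : ℂ) * I_sq
  · linear_combination (-1 / 2 : ℂ) * I_sq
  · ring
  · ring

theorem kleinAut_of_even (hk : k * k = 1) {A : H →L[ℂ] H} (hA : k * A * k = A) :
    kleinAut k hk A = A := by
  have hcomm : k * A = A * k := by
    rw [← mul_one (k * A), ← hk, ← mul_assoc, hA]
  rw [kleinAut_eq, hA, hcomm]
  module

theorem kleinAut_of_odd (hk : k * k = 1) {B : H →L[ℂ] H} (hB : k * B * k = -B) :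
    kleinAut k hk B = I • (k * B) := by
  have hanti : B * k = -(k * B) := by
    rw [← mul_one (k * B), ← hk, ← mul_assoc, hB, neg_mul, neg_neg]
  rw [kleinAut_eq, hB, hanti]
  module

/-- `S` is closed under linear combinations and under conjugation by the involution `k`: up to
being nonempty, it is one of the `k`-invariant linear spaces of operators that can be twisted. -/
structure IsGradedSpace (k : H →L[ℂ] H) (S : Set (H →L[ℂ] H)) : Prop where
  add_mem : ∀ {A B}, A ∈ S → B ∈ S → A + B ∈ S
  smul_mem : ∀ (c : ℂ) {A}, A ∈ S → c • A ∈ S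
  conj_mem : ∀ {A}, A ∈ S → k * A * k ∈ S

namespace IsGradedSpace

variable {S T : Set (H →L[ℂ] H)}

theorem twist_eq_image (hS : IsGradedSpace k S) (hk : k * k = 1) :
    twist k S = kleinAut k hk '' S := by
  have hkk : ∀ X : H →L[ℂ] H, k * (k * X) = X := fun X => by rw [← mul_assoc, hk, one_mul]
  ext X
  constructor
  · rintro ⟨A, hA, B, hB, hAk, hBk, rfl⟩
    exact ⟨A + B, hS.add_mem hA hB,
      by rw [map_add, kleinAut_of_even hk hAk, kleinAut_of_odd hk hBk]⟩
  · rintro ⟨A, hA, rfl⟩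
    have heven := hS.smul_mem (1 / 2) (hS.add_mem hA (hS.conj_mem hA))
    have hodd := hS.smul_mem (1 / 2) (hS.add_mem hA (hS.smul_mem (-1) (hS.conj_mem hA)))
    refine ⟨_, heven, _, hodd, ?_, ?_, ?_⟩ <;>
      simp only [kleinAut_eq, mul_add, add_mul, smul_mul_assoc, mul_smul_comm, mul_assoc, hkk, hk,
        mul_one] <;>
      module

theorem image (hS : IsGradedSpace k S) (φ : (H →L[ℂ] H) →ₗ[ℂ] (H' →L[ℂ] H'))
    (hφ : ∀ A, φ (k * A) = k' * φ A) (hφ' : ∀ A, φ (A * k) = φ A * k') :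
    IsGradedSpace k' (φ '' S) where
  add_mem := by
    rintro _ _ ⟨A, hA, rfl⟩ ⟨B, hB, rfl⟩
    exact ⟨A + B, hS.add_mem hA hB, map_add φ A B⟩
  smul_mem := by
    rintro c _ ⟨A, hA, rfl⟩
    exact ⟨c • A, hS.smul_mem c hA, map_smul φ c A⟩
  conj_mem := by
    rintro _ ⟨A, hA, rfl⟩
    exact ⟨k * A * k, hS.conj_mem hA, by rw [hφ', hφ]⟩

theorem twist_image (hS : IsGradedSpace k S) (hk : k * k = 1) (hk' : k' * k' = 1)
    (φ : (H →L[ℂ] H) →ₗ[ℂ] (H' →L[ℂ] H'))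
    (hφ : ∀ A, φ (k * A) = k' * φ A) (hφ' : ∀ A, φ (A * k) = φ A * k') :
    twist k' (φ '' S) = φ '' twist k S := by
  have hklein : ∀ A, kleinAut k' hk' (φ A) = φ (kleinAut k hk A) := fun A => by
    simp only [kleinAut_eq, map_add, map_sub, map_smul, hφ, hφ']
  rw [(hS.image φ hφ hφ').twist_eq_image hk', hS.twist_eq_image hk]
  simp only [Set.image_image, hklein]

theorem commute_of_commute_twist (hS : IsGradedSpace k S) (hT : IsGradedSpace k T)
    (hk : k * k = 1) (h : ∀ A ∈ S, ∀ Y ∈ twist k T, Commute Y A) :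
    ∀ B ∈ T, ∀ X ∈ twist k S, Commute X B := by
  rw [hT.twist_eq_image hk] at h
  rw [hS.twist_eq_image hk]
  rintro B hB _ ⟨A, hA, rfl⟩
  refine Commute.of_map (kleinAut k hk).injective ?_
  rw [kleinAut_kleinAut]
  exact (h _ (hS.conj_mem hA) _ (Set.mem_image_of_mem _ hB)).symm

end IsGradedSpace

theorem mem_twistedDual_iff {d : ℕ} {S : DoubleCone d → Set (H →L[ℂ] H)} {O : DoubleCone d}
    {X : H →L[ℂ] H} : X ∈ twistedDual k S O ↔
      ∀ O₁ : DoubleCone d, O₁.Spacelike O → ∀ Y ∈ twist k (S O₁), Commute Y X := by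
  simp only [twistedDual, Set.mem_iInter]
  rfl

theorem subset_twistedDual_of_subset_twistedDual {d : ℕ} {S T : DoubleCone d → Set (H →L[ℂ] H)}
    (hk : k * k = 1) (hS : ∀ O, IsGradedSpace k (S O)) (hT : ∀ O, IsGradedSpace k (T O))
    (h : ∀ O, S O ⊆ twistedDual k T O) (O : DoubleCone d) : T O ⊆ twistedDual k S O :=
  fun B hB => mem_twistedDual_iff.2 fun O₁ hO₁ X hX =>
    (hS O₁).commute_of_commute_twist (hT O) hk
      (fun _ hA => mem_twistedDual_iff.1 (h O₁ hA) O hO₁.symm) B hB X hX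

end KleinTransformation

section Compression

variable {H : Type*} [NormedAddCommGroup H] [InnerProductSpace ℂ H] {E k : H →L[ℂ] H}

/-- The map `A ↦ E A E` as a linear map. -/
def cornerMap (E : H →L[ℂ] H) : (H →L[ℂ] H) →ₗ[ℂ] (H →L[ℂ] H) :=
  LinearMap.mulLeftRight ℂ (E, E)

theorem cornerMap_apply (E A : H →L[ℂ] H) : cornerMap E A = E * A * E :=
  rfl

theorem cornerMap_mul_left (hEk : Commute E k) (A : H →L[ℂ] H) :
    cornerMap E (k * A) = k * cornerMap E A := by
  simp only [cornerMap_apply, ← mul_assoc, hEk.eq]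

theorem cornerMap_mul_right (hEk : Commute E k) (A : H →L[ℂ] H) :
    cornerMap E (A * k) = cornerMap E A * k := by
  simp only [cornerMap_apply, mul_assoc, hEk.eq]

/-- The compression `A ↦ E A E` to `E H`, as a linear map. -/
def compressMap (E : H →L[ℂ] H) : (H →L[ℂ] H) →ₗ[ℂ] (E.range →L[ℂ] E.range) where
  toFun := compress E
  map_add' A B := by ext; simp [compress]
  map_smul' c A := by ext; simp [compress]

theorem rangeRestrict_coe (hE : E * E = E) (x : E.range) : E.rangeRestrict (x : H) = x := by
  obtain ⟨_, y, rfl⟩ := x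
  exact Subtype.ext (DFunLike.congr_fun hE y)

theorem compress_surjective (hE : E * E = E) : Function.Surjective (compress E) := by
  refine fun X => ⟨E.range.subtypeL ∘L X ∘L E.rangeRestrict, ContinuousLinearMap.ext fun x => ?_⟩
  change E.rangeRestrict (X (E.rangeRestrict x)) = X x
  rw [rangeRestrict_coe hE, rangeRestrict_coe hE]

theorem compress_one (hE : E * E = E) : compress E 1 = 1 :=
  ContinuousLinearMap.ext (rangeRestrict_coe hE)

theorem compress_mul_compress (A B : H →L[ℂ] H) :
    compress E A * compress E B = compress E (A * E * B) :=
  rfl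

theorem compress_eq_compress_iff (hE : E * E = E) {A B : H →L[ℂ] H} :
    compress E A = compress E B ↔ E * A * E = E * B * E := by
  constructor <;> intro h <;> ext x
  · exact congrArg Subtype.val (DFunLike.congr_fun h (E.rangeRestrict x))
  · rw [coe_compress_apply E A hE, coe_compress_apply E B hE, h]

theorem compress_mul_left (hE : E * E = E) (hEk : Commute E k) (A : H →L[ℂ] H) :
    compress E (k * A) = compress E k * compress E A := by
  rw [compress_mul_compress, compress_eq_compress_iff hE, ← hEk.eq]
  simp only [← mul_assoc, hE]

theorem compress_mul_right (hE : E * E = E) (hEk : Commute E k) (A : H →L[ℂ] H) :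
    compress E (A * k) = compress E A * compress E k := by
  rw [compress_mul_compress, compress_eq_compress_iff hE, mul_assoc A E k, hEk.eq]
  simp only [mul_assoc, hE]

theorem commute_compress_iff (hE : E * E = E) (A B : H →L[ℂ] H) :
    Commute (compress E A) (compress E B) ↔ Commute (E * A * E) (E * B * E) := by
  have hmul : ∀ A B : H →L[ℂ] H, E * (A * E * B) * E = E * A * E * (E * B * E) := by
    intro A B
    calc E * (A * E * B) * E = E * A * (E * E) * B * E := by simp only [hE, mul_assoc]
      _ = E * A * E * (E * B * E) := by simp only [mul_assoc]
  rw [commute_iff_eq, commute_iff_eq, compress_mul_compress, compress_mul_compress,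
    compress_eq_compress_iff hE, hmul, hmul]

variable {d : ℕ} {S : DoubleCone d → Set (H →L[ℂ] H)} {O : DoubleCone d}

theorem IsGradedSpace.corner (hS : IsGradedSpace k (S O)) (hEk : Commute E k) :
    IsGradedSpace k (corner E S O) :=
  hS.image (cornerMap E) (cornerMap_mul_left hEk) (cornerMap_mul_right hEk)

theorem mem_twistedDual_corner_iff (hEk : Commute E k) (hk : k * k = 1)
    (hS : ∀ O, IsGradedSpace k (S O)) {X : H →L[ℂ] H} :
    X ∈ twistedDual k (corner E S) O ↔ ∀ O₁ : DoubleCone d, O₁.Spacelike O →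
      ∀ Y ∈ twist k (S O₁), Commute (E * Y * E) X := by
  rw [mem_twistedDual_iff]
  refine forall₂_congr fun O₁ _ => ?_
  rw [show twist k (corner E S O₁) = cornerMap E '' twist k (S O₁) from
    (hS O₁).twist_image hk hk _ (cornerMap_mul_left hEk) (cornerMap_mul_right hEk)]
  exact Set.forall_mem_image

theorem compress_mem_twistedDual_iff (hE : E * E = E) (hEk : Commute E k) (hk : k * k = 1)
    (hS : ∀ O, IsGradedSpace k (S O)) {A : H →L[ℂ] H} :
    compress E A ∈ twistedDual (compress E k) (compressedNet E S) O ↔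
      E * A * E ∈ twistedDual k (corner E S) O := by
  have hk' : compress E k * compress E k = 1 := by
    rw [← compress_mul_left hE hEk, hk, compress_one hE]
  rw [mem_twistedDual_corner_iff hEk hk hS, mem_twistedDual_iff]
  refine forall₂_congr fun O₁ _ => ?_
  rw [show twist (compress E k) (compressedNet E S O₁) = compressMap E '' twist k (S O₁) from
    (hS O₁).twist_image hk hk' (compressMap E) (compress_mul_left hE hEk)
      (compress_mul_right hE hEk)]
  exact Set.forall_mem_image.trans (forall₂_congr fun Y _ => commute_compress_iff hE Y A)

end Compression

namespace GradedNet

variable {d : ℕ} {H : Type*} [NormedAddCommGroup H] [InnerProductSpace ℂ H] [CompleteSpace H]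
  (F : GradedNet d H) {E : H →L[ℂ] H}

theorem isGradedSpace (O : DoubleCone d) : IsGradedSpace F.k (F.sets O) where
  add_mem hA hB := add_mem (S := VonNeumannAlgebra H) hA hB
  smul_mem c _ hA := (F.algebra O).toStarSubalgebra.smul_mem hA c
  conj_mem hA := F.k_conj_mem O _ hA

theorem twist_eq_image (O : DoubleCone d) :
    twist F.k (F.sets O) = kleinAut F.k F.k_mul_k '' F.sets O :=
  (F.isGradedSpace O).twist_eq_image F.k_mul_k

/-- The twist `Fᵗ(O)`, a monoid since it is the image of `F(O)` under an algebra automorphism. -/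
noncomputable def twistMonoid (O : DoubleCone d) : Submonoid (H →L[ℂ] H) :=
  ((F.algebra O).toStarSubalgebra.toSubalgebra.toSubmonoid.map
    (kleinAut F.k F.k_mul_k)).copy (twist F.k (F.sets O)) (F.twist_eq_image O)

theorem twist_mono {O₁ O₂ : DoubleCone d} (h : O₁ ≤ O₂) :
    twist F.k (F.sets O₁) ⊆ twist F.k (F.sets O₂) := by
  rw [twist_eq_image, twist_eq_image]
  exact Set.image_mono (F.isotony O₁ O₂ h)

variable {F}

theorem isCyclicForSet_twist (hEk : Commute E F.k) (hcyc : IsCyclicFor E F.sets)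
    (O : DoubleCone d) : IsCyclicForSet E (twist F.k (F.sets O)) := by
  have hZE : Commute (kleinUnit F.k F.k_mul_k : H →L[ℂ] H) E :=
    ((((Commute.one_left E).smul_left _).add_left (hEk.symm.smul_left _)).smul_left _)
  rw [twist_eq_image]
  exact (isCyclicFor_iff.1 hcyc O).image_conj (Units.mul_inv _) (Units.inv_mul _) hZE

theorem injOn_mul_right_dual (hd : 1 ≤ d) (hEk : Commute E F.k) (hcyc : IsCyclicFor E F.sets)
    (O : DoubleCone d) : Set.InjOn (· * E) (F.dual.sets O) := by
  obtain ⟨O₁, hO₁⟩ := DoubleCone.exists_spacelike hd O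
  exact (isCyclicForSet_twist hEk hcyc O₁).injOn_mul_right_centralizer.mono
    fun _ hT => mem_twistedDual_iff.1 hT O₁ hO₁

theorem exists_mem_dual_of_mem_twistedDual_corner (hd : 2 ≤ d) (hE : IsStarProjection E)
    (hEk : Commute E F.k) (hcyc : IsCyclicFor E F.sets) {O : DoubleCone d} {X : H →L[ℂ] H}
    (hX : X ∈ twistedDual F.k (corner E F.sets) O) :
    ∃ T ∈ F.dual.algebra O, Commute T E ∧ T * E = X * E := by
  rw [mem_twistedDual_corner_iff hEk F.k_mul_k F.isGradedSpace] at hX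
  have hexists : ∀ O₁ : DoubleCone d, O₁.Spacelike O →
      ∃ T ∈ (twist F.k (F.sets O₁)).centralizer, Commute T E ∧ T * E = X * E := fun O₁ hO₁ =>
    exists_mem_centralizer_extension (S := F.twistMonoid O₁) (fun _ => F.star_mem_twist O₁) hE
      (isCyclicForSet_twist hEk hcyc O₁) fun Y hY => (hX O₁ hO₁ Y hY).symm
  choose! T hTmem hTE hTX using hexists
  have hmono : ∀ O₁ O₂, O₂.Spacelike O → O₁ ≤ O₂ → T O₁ = T O₂ := fun O₁ O₂ hO₂ h => by
    have hO₁ : O₁.Spacelike O := fun _ hx => hO₂ (h hx)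
    exact (isCyclicForSet_twist hEk hcyc O₁).injOn_mul_right_centralizer (hTmem O₁ hO₁)
      (Set.centralizer_subset (F.twist_mono h) (hTmem O₂ hO₂))
      ((hTX O₁ hO₁).trans (hTX O₂ hO₂).symm)
  obtain ⟨O₁, hO₁⟩ := DoubleCone.exists_spacelike (one_le_two.trans hd) O
  refine ⟨T O₁, mem_twistedDual_iff.2 fun O₂ hO₂ Y hY => ?_, hTE O₁ hO₁, hTX O₁ hO₁⟩
  rw [DoubleCone.eq_of_spacelike hd hmono hO₁ hO₂]
  exact hTmem O₂ hO₂ Y hY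

end GradedNet

section PositiveMaps

variable {H : Type*} [NormedAddCommGroup H] [InnerProductSpace ℂ H] [CompleteSpace H]
  {M : VonNeumannAlgebra H} {E : H →L[ℂ] H}

theorem IsConditionalExpectation.map_star {m : M.toStarSubalgebra →ₗ[ℂ] M.toStarSubalgebra}
    (hm : IsConditionalExpectation M m) (X : M.toStarSubalgebra) : m (star X) = star (m X) := by
  have hpos : ∀ Y : M.toStarSubalgebra, (Y : H →L[ℂ] H).IsPositive → star (m Y) = m Y :=
    fun Y hY => Subtype.ext (hm.pos Y hY).isSelfAdjoint
  have hsa : ∀ Y : M.toStarSubalgebra, IsSelfAdjoint Y → star (m Y) = m Y := by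
    intro Y hY
    have hle := IsSelfAdjoint.le_algebraMap_norm_self (a := (Y : H →L[ℂ] H))
      (congrArg Subtype.val hY)
    rw [Algebra.algebraMap_eq_smul_one, ← Complex.coe_smul, ContinuousLinearMap.le_def] at hle
    have hstar := hpos (((‖(Y : H →L[ℂ] H)‖ : ℝ) : ℂ) • 1 - Y) hle
    rw [map_sub, map_smul, hm.map_one, star_sub, star_smul, star_one] at hstar
    simpa using hstar
  have hre := hsa _ (realPart X).2
  have him := hsa _ (imaginaryPart X).2
  rw [← realPart_add_I_smul_imaginaryPart X]
  simp only [star_add, star_smul, map_add, map_smul, hre, him, (realPart X).2.star_eq,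
    (imaginaryPart X).2.star_eq]

theorem IsConditionalExpectation.commute {m : M.toStarSubalgebra →ₗ[ℂ] M.toStarSubalgebra}
    (hm : IsConditionalExpectation M m) (hE : IsSelfAdjoint E)
    (hmE : ∀ A, (m A : H →L[ℂ] H) * E = E * A * E) (A : M.toStarSubalgebra) :
    Commute (m A : H →L[ℂ] H) E := by
  have hstar := congrArg star (hmE (star A))
  rw [hm.map_star] at hstar
  have hEm : E * (m A : H →L[ℂ] H) = E * A * E := by simpa [hE.star_eq, mul_assoc] using hstar
  exact (hmE A).trans hEm.symm

theorem cfcAbs_mem {T : H →L[ℂ] H} (hT : T ∈ M) : CFC.abs T ∈ M := by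
  rw [← VonNeumannAlgebra.commutant_commutant M, VonNeumannAlgebra.mem_commutant_iff]
  have hcomm : ∀ Y ∈ M.commutant, Commute T Y := fun Y hY =>
    VonNeumannAlgebra.mem_commutant_iff.1 hY T hT
  exact fun Y hY => (hcomm Y hY).cfcAbs_right (hcomm _ (star_mem hY))

theorem nonneg_of_mul_projection_nonneg (hE : IsStarProjection E)
    (hsep : Set.InjOn (· * E) (M : Set (H →L[ℂ] H)))
    {T : H →L[ℂ] H} (hT : T ∈ M) (hTE : Commute T E) (hpos : 0 ≤ T * E) : 0 ≤ T := by
  have habs : T * E = CFC.abs T * E := by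
    rw [← CFC.abs_of_nonneg _ hpos, hTE.cfcAbs_mul_eq (hE.isSelfAdjoint.star_eq.symm ▸ hTE),
      CFC.abs_of_nonneg E hE.nonneg]
  rw [hsep hT (cfcAbs_mem hT) habs]
  exact CFC.abs_nonneg T

theorem exists_isConditionalExpectation (hE : IsStarProjection E)
    (hsep : Set.InjOn (· * E) (M : Set (H →L[ℂ] H)))
    (hlift : ∀ A ∈ M, ∃ T ∈ M, Commute T E ∧ T * E = E * A * E) :
    ∃ m, IsConditionalExpectation M m ∧ ∀ A, (m A : H →L[ℂ] H) * E = E * A * E := by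
  have hEE : E * E = E := hE.isIdempotentElem
  have huniq : ∀ {A B : M.toStarSubalgebra}, (A : H →L[ℂ] H) * E = B * E → A = B :=
    fun {A B} h => Subtype.ext (hsep A.2 B.2 h)
  obtain ⟨m, hmE, hmA⟩ : ∃ m : M.toStarSubalgebra →ₗ[ℂ] M.toStarSubalgebra,
      (∀ A, Commute (m A : H →L[ℂ] H) E) ∧ ∀ A, (m A : H →L[ℂ] H) * E = E * A * E := by
    choose T hT hTE hTA using fun A : M.toStarSubalgebra => hlift A A.2
    exact ⟨{ toFun := fun A => ⟨T A, hT A⟩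
             map_add' := fun A B => huniq (by simp [hTA, mul_add, add_mul])
             map_smul' := fun c A => huniq (by simp [hTA]) }, hTE, hTA⟩
  refine ⟨m, ⟨fun A => huniq ?_, huniq ?_, fun A hA => ?_, fun A B C => huniq ?_⟩, hmA⟩
  · rw [hmA, ← (hmE A).eq, mul_assoc, hEE]
  · rw [hmA, OneMemClass.coe_one, mul_one, one_mul, hEE]
  · rw [← ContinuousLinearMap.nonneg_iff_isPositive] at hA ⊢
    refine nonneg_of_mul_projection_nonneg hE hsep (m A).2 (hmE A) ?_
    rw [hmA]
    exact hE.isSelfAdjoint.conjugate_nonneg hA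
  · rw [hmA]
    change E * (m A * B * m C : H →L[ℂ] H) * E = (m A * m B * m C : H →L[ℂ] H) * E
    calc E * (m A * B * m C : H →L[ℂ] H) * E
        = (E * m A) * B * (m C * E) := by simp only [mul_assoc]
      _ = m A * (E * B * E) * m C := by
        rw [← (hmE A).eq, (hmE C).eq]
        simp only [mul_assoc]
      _ = m A * m B * (E * m C) := by
        rw [← hmA]
        simp only [mul_assoc]
      _ = (m A * m B * m C : H →L[ℂ] H) * E := by
        rw [← (hmE C).eq]
        simp only [mul_assoc]

end PositiveMaps

namespace GradedNet

variable {d : ℕ} {H : Type*} [NormedAddCommGroup H] [InnerProductSpace ℂ H] [CompleteSpace H]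
  {F : GradedNet d H} {E : H →L[ℂ] H}

theorem hasConditionalExpectationFor_iff (hE : IsStarProjection E)
    (hsep : ∀ O, Set.InjOn (· * E) (F.sets O)) :
    HasConditionalExpectationFor F E ↔
      ∀ O, ∀ A ∈ F.algebra O, ∃ T ∈ F.algebra O, Commute T E ∧ T * E = E * A * E := by
  constructor
  · rintro ⟨m, hm⟩ O A hA
    exact ⟨m.map O ⟨A, hA⟩, (m.map O ⟨A, hA⟩).2,
      (m.isConditionalExpectation O).commute hE.isSelfAdjoint (hm O) ⟨A, hA⟩, hm O ⟨A, hA⟩⟩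
  · intro hlift
    choose m hm hmE using fun O => exists_isConditionalExpectation hE (hsep O) (hlift O)
    refine ⟨⟨m, hm, fun O₁ O₂ h A => hsep O₂ (m O₂ _).2 (F.isotony O₁ O₂ h (m O₁ A).2) ?_⟩, hmE⟩
    exact (hmE O₂ _).trans (hmE O₁ A).symm

theorem hasConditionalExpectationFor_dual_iff (hd : 2 ≤ d) (hE : IsStarProjection E)
    (hEk : Commute E F.k) (hcyc : IsCyclicFor E F.sets) :
    HasConditionalExpectationFor F.dual E ↔
      ∀ O, corner E F.dual.sets O ⊆ twistedDual F.k (corner E F.sets) O := by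
  have hEE : E * E = E := hE.isIdempotentElem
  rw [hasConditionalExpectationFor_iff hE (injOn_mul_right_dual (one_le_two.trans hd) hEk hcyc)]
  refine forall_congr' fun O => ⟨?_, fun hcorner A hA => ?_⟩
  · rintro hlift _ ⟨A, hA, rfl⟩
    obtain ⟨T, hT, hTE, hTA⟩ := hlift A hA
    refine (mem_twistedDual_corner_iff hEk F.k_mul_k F.isGradedSpace).2 fun O₁ hO₁ Y hY => ?_
    have hYT : Commute Y T := mem_twistedDual_iff.1 hT O₁ hO₁ Y hY
    have hcornerT : Commute (E * Y * E) T := (hTE.symm.mul_left hYT).mul_left hTE.symm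
    have hcornerE : Commute (E * Y * E) E := by
      rw [commute_iff_eq, mul_assoc _ E E, ← mul_assoc E, ← mul_assoc E, hEE]
    change Commute (E * Y * E) (E * A * E)
    rw [← hTA]
    exact hcornerT.mul_right hcornerE
  · obtain ⟨T, hT, hTE, hTA⟩ :=
      exists_mem_dual_of_mem_twistedDual_corner hd hE hEk hcyc (hcorner ⟨A, hA, rfl⟩)
    exact ⟨T, hT, hTE, by rw [hTA, mul_assoc, hEE]⟩

theorem twistedDual_compressedNet_eq_iff (hd : 2 ≤ d) (hE : IsStarProjection E)
    (hEk : Commute E F.k) (hcyc : IsCyclicFor E F.sets) :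
    twistedDual (compress E F.k) (compressedNet E F.sets) = compressedNet E F.dual.sets ↔
      ∀ O, corner E F.dual.sets O ⊆ twistedDual F.k (corner E F.sets) O := by
  have hEE : E * E = E := hE.isIdempotentElem
  have hmem : ∀ {O A}, compress E A ∈ twistedDual (compress E F.k) (compressedNet E F.sets) O ↔
      E * A * E ∈ twistedDual F.k (corner E F.sets) O :=
    compress_mem_twistedDual_iff hEE hEk F.k_mul_k F.isGradedSpace
  have hle : twistedDual (compress E F.k) (compressedNet E F.sets) ≤
      compressedNet E F.dual.sets := by
    intro O X hX
    obtain ⟨A, rfl⟩ := compress_surjective hEE X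
    obtain ⟨T, hT, -, hTA⟩ :=
      exists_mem_dual_of_mem_twistedDual_corner hd hE hEk hcyc (hmem.1 hX)
    refine ⟨T, hT, (compress_eq_compress_iff hEE).2 ?_⟩
    rw [mul_assoc, hTA, mul_assoc _ E E, hEE, ← mul_assoc, ← mul_assoc, hEE]
  rw [le_antisymm_iff, and_iff_right hle]
  refine forall_congr' fun O => Set.image_subset_iff.trans (Set.image_subset_iff.trans ?_).symm
  exact forall₂_congr fun A _ => hmem.symm

end GradedNet

theorem corollary3p3 {d : ℕ} (hd : 2 ≤ d)
    {H : Type*} [NormedAddCommGroup H] [InnerProductSpace ℂ H] [CompleteSpace H]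
    (F : GradedNet d H) (hF : F.dual.dual = F)
    (E : H →L[ℂ] H) (hE : IsStarProjection E) (hEk : Commute E F.k)
    (hcyc : IsCyclicFor E F.sets) (hcyc_dual : IsCyclicFor E F.dual.sets) :
    List.TFAE [
      HasConditionalExpectationFor F E,
      HasConditionalExpectationFor F.dual E,
      ∀ O : DoubleCone d, corner E F.sets O ⊆ twistedDual F.k (corner E F.dual.sets) O,
      ∀ O : DoubleCone d, corner E F.dual.sets O ⊆ twistedDual F.k (corner E F.sets) O,
      twistedDual (compress E F.k) (compressedNet E F.sets) = compressedNet E F.dual.sets,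
      twistedDual (compress E F.k) (compressedNet E F.dual.sets) = compressedNet E F.sets] := by
  have hEk' : Commute E F.dual.k := hEk
  have ha := GradedNet.hasConditionalExpectationFor_dual_iff hd hE hEk' hcyc_dual
  have hc' := GradedNet.twistedDual_compressedNet_eq_iff hd hE hEk' hcyc_dual
  rw [hF] at ha hc'
  have hgraded := fun O => (F.isGradedSpace O).corner hEk
  have hgraded_dual := fun O => (F.dual.isGradedSpace O).corner hEk'
  tfae_have 1 ↔ 3 := ha
  tfae_have 2 ↔ 4 := GradedNet.hasConditionalExpectationFor_dual_iff hd hE hEk hcyc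
  tfae_have 3 → 4 := subset_twistedDual_of_subset_twistedDual F.k_mul_k hgraded hgraded_dual
  tfae_have 4 → 3 := subset_twistedDual_of_subset_twistedDual F.k_mul_k hgraded_dual hgraded
  tfae_have 5 ↔ 4 := GradedNet.twistedDual_compressedNet_eq_iff hd hE hEk hcyc
  tfae_have 6 ↔ 3 := hc'
  tfae_finish
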